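/- Let $N\ge 1$ and let $H_x$, $x\in[0,1]$, be a path of self-adjoint $N\times N$ complex matrices that is smooth ($C^2$ suffices), with eigenvalues in nondecreasing order $e_0(x)\le e_1(x)\le\dots\le e_{N-1}(x)$ (counted with multiplicity), and let $\gamma:[0,1]\to[0,\infty)$ be smooth ($C^1$ suffices). Assume the gap condition $e_a(x)\neq e_b(x)$ for all $a\ne b$ and all $x\in[0,1]$, and let $P_a(x)$ be the spectral projection of $H_x$ belonging to $e_a(x)$. Consider the dephasing Lindbladian $$\mathcal L_x(\rho)=-i[H_x,\rho]-\gamma(x)\sum_{j\neq k}P_j(x)\,\rho\,P_k(x).$$ Then $P_0$ is differentiable on $[0,1]$, and, with $P_0'=dP_0/dx$, the mass term $$M(x)=\sum_{a\neq 0}\frac{\gamma(x)\,\mathrm{tr}\bigl(P_a(x)\,P_0'(x)^2\bigr)}{(e_0(x)-e_a(x))^2+\gamma(x)^2},$$ which depends only on the path $(H_x,\gamma(x))$ and not on any parametrization of it, satisfies $M(x)\ge 0$ on $[0,1]$. For every parametrization $q:[0,1]\to[0,1]$ of class $C^2$, the function $s\mapsto M(q(s))\,\dot q(s)^2$ is integrable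 on $[0,1]$; and if for $\varepsilon>0$ the matrix function $\rho_{q,\varepsilon}$ solves $\varepsilon\dot\rho(s)=\mathcal L_{q(s)}(\rho(s))$, $0\le s\le 1$, with initial condition $\rho(0)=P_0(q(0))$, then the tunneling $T_{q,\varepsilon}(s)=1-\mathrm{tr}\bigl(P_0(q(s))\rho_{q,\varepsilon}(s)\bigr)$ satisfies $$T_{q,\varepsilon}(1)=2\varepsilon\int_0^1 M(q(s))\,\dot q(s)^2\,ds+O(\varepsilon^2).$$ The error is uniform in the parametrization: for every $K$ there is a constant $C$ (depending only on $K$ and on the path $(H_x,\gamma(x))$) such that $$\Bigl|T_{q,\varepsilon}(1)-2\varepsilon\int_0^1 M(q(s))\,\dot q(s)^2\,ds\Bigr|\le C\varepsilon^2$$ for all $\varepsilon>0$ and all $C^2$ parametrizations $q:[0,1]\to[0,1]$ with $|\dot q|\le K$ and $|\ddot q|\le K$ on $[0,1]$. Every fixed $q$ satisfies such bounds for some $K$, and $q=q_\varepsilon$ may depend on $\varepsilon$ as long as $K$ does not. -/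

import Mathlib

open Set MeasureTheory
open scoped Matrix Matrix.Norms.Frobenius ContDiff

namespace Dephasing

noncomputable section

open Classical in
/-- The `a`-th eigenvalue `e_a` of a self-adjoint matrix `A`, the eigenvalues being counted with
multiplicity and listed in nondecreasing order `e_0 ≤ e_1 ≤ … ≤ e_{N-1}`. Mathlib's list
`eigenvalues₀` is nonincreasing, hence the reversal. (The value is `0` if `A` is not
self-adjoint.) -/
def energy {N : ℕ} (A : Matrix (Fin N) (Fin N) ℂ) (a : Fin N) : ℝ :=
  if hA : A.IsHermitian then hA.eigenvalues₀ (Fin.cast (Fintype.card_fin N).symm a.rev) else 0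

open Classical in
/-- The spectral projection `P_a` of a self-adjoint matrix `A` belonging to the eigenvalue `e_a`:
the functional calculus of `A` applied to the indicator function of `{e_a}`.
(The value is `0` if `A` is not self-adjoint.) -/
def specProj {N : ℕ} (A : Matrix (Fin N) (Fin N) ℂ) (a : Fin N) : Matrix (Fin N) (Fin N) ℂ :=
  if hA : A.IsHermitian then hA.cfc (fun x : ℝ => if x = energy A a then 1 else 0) else 0

/-- The dephasing Lindbladian
`ρ ↦ -i [A, ρ] - g ∑_{j ≠ k} P_j ρ P_k` of the Hamiltonian `A` with dephasing rate `g`. -/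
def lindbladian {N : ℕ} (A : Matrix (Fin N) (Fin N) ℂ) (g : ℝ) (ρ : Matrix (Fin N) (Fin N) ℂ) :
    Matrix (Fin N) (Fin N) ℂ :=
  -Complex.I • (A * ρ - ρ * A) -
    (g : ℂ) • ∑ j, ∑ k, if j ≠ k then specProj A j * ρ * specProj A k else 0

/-- `ρ` solves the adiabatic evolution equation `ε ρ̇(s) = L_{q(s)}(ρ(s))`, `0 ≤ s ≤ 1`, and starts
in the ground state `P_0` at the initial point of the path. -/
structure IsAdiabaticEvolution {N : ℕ} [NeZero N] (H : ℝ → Matrix (Fin N) (Fin N) ℂ) (γ : ℝ → ℝ)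
    (q : ℝ → ℝ) (ε : ℝ) (ρ : ℝ → Matrix (Fin N) (Fin N) ℂ) : Prop where
  init : ρ 0 = specProj (H (q 0)) 0
  evolve : ∀ s ∈ Icc (0 : ℝ) 1, ∃ v : Matrix (Fin N) (Fin N) ℂ,
    HasDerivWithinAt ρ v (Icc 0 1) s ∧ (ε : ℂ) • v = lindbladian (H (q s)) (γ (q s)) (ρ s)

/-- The tunneling `T(s) = 1 - tr (P_0(q(s)) ρ(s))`. -/
def tunneling {N : ℕ} [NeZero N] (H : ℝ → Matrix (Fin N) (Fin N) ℂ) (q : ℝ → ℝ)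
    (ρ : ℝ → Matrix (Fin N) (Fin N) ℂ) (s : ℝ) : ℝ :=
  1 - (specProj (H (q s)) 0 * ρ s).trace.re

/-- The derivative `P_0'(x)` of the ground state projection along the path `H_x`, `0 ≤ x ≤ 1`
(one-sided at the end points). -/
def groundProjDeriv {N : ℕ} [NeZero N] (H : ℝ → Matrix (Fin N) (Fin N) ℂ) (x : ℝ) :
    Matrix (Fin N) (Fin N) ℂ :=
  derivWithin (fun y => specProj (H y) 0) (Icc 0 1) x

/-- The mass term `M(x) = ∑_{a ≠ 0} γ tr (P_a P_0'²) / ((e_0 - e_a)² + γ²)`, a function of the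
point `x` of the path. -/
def mass {N : ℕ} [NeZero N] (H : ℝ → Matrix (Fin N) (Fin N) ℂ) (γ : ℝ → ℝ) (x : ℝ) : ℝ :=
  ∑ a ∈ Finset.univ.filter (fun a : Fin N => a ≠ 0),
    γ x * (specProj (H x) a * groundProjDeriv H x ^ 2).trace.re /
      ((energy (H x) 0 - energy (H x) a) ^ 2 + γ x ^ 2)

end

end Dephasing

/-!
Regard `N × N` matrices as a real Hilbert space under `⟪X, Y⟫ = Re tr (Xᴴ Y)`. The Lindbladian `L`
acts on the block `P_j X P_k` as multiplication by a scalar which vanishes for `j = k`, and has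
nonpositive real part and is nonzero for `j ≠ k`. Hence `L` is dissipative, annihilates `P = P_0`,
and can be inverted on matrices without diagonal blocks. The velocity `P'` of the ground state
projection is such a matrix, so there are `B` and `Y` with `L B = P'` and `L* Y = P'`. Dissipativity
applied to `ρ - P - ε B` gives `ρ - P = O(ε)`. Since `L* P = 0`, also
`⟪P, ρ⟫' = ⟪P', ρ⟫ = ⟪Y, L ρ⟫ = ε ⟪Y, ρ'⟫`, and an integration by parts replaces `ρ'` by `P'` up to
`O(ε²)`; in the eigenbasis `⟪Y, P'⟫ = -2 M q'²`. All bounds come from the compactness of `[0, 1]`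
and the `C²` dependence of eigenvalues and projections on `x`, which the gap condition provides
through the implicit function theorem.
-/

namespace Dephasing

section DissipativeEvolution

open scoped RealInnerProductSpace

variable {E : Type*} [NormedAddCommGroup E] {a b : ℝ}

section Integral

variable [NormedSpace ℝ E] [CompleteSpace E]

lemma hasDerivWithinAt_integral_Icc {f : ℝ → E} (hf : ContinuousOn f (Icc a b)) {s : ℝ}
    (hs : s ∈ Icc a b) :
    HasDerivWithinAt (fun t => ∫ u in a..t, f u) (f s) (Icc a b) s := by
  have : Fact (s ∈ Icc a b) := ⟨hs⟩
  have hint : IntervalIntegrable f volume a s :=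
    (hf.mono (Icc_subset_Icc_right hs.2)).intervalIntegrable_of_Icc hs.1
  exact intervalIntegral.integral_hasDerivWithinAt_right hint
    (hf.stronglyMeasurableAtFilter_nhdsWithin measurableSet_Icc s) (hf s hs)

lemma norm_sub_sub_integral_le {F F' f : ℝ → E} {C : ℝ} (hab : a ≤ b)
    (hF : ∀ s ∈ Icc a b, HasDerivWithinAt F (F' s) (Icc a b) s)
    (hf : ContinuousOn f (Icc a b)) (hC : ∀ s ∈ Icc a b, ‖F' s - f s‖ ≤ C) :
    ‖F b - F a - ∫ s in a..b, f s‖ ≤ C * (b - a) := by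
  have hG : ∀ s ∈ Icc a b, HasDerivWithinAt (fun t => F t - ∫ u in a..t, f u) (F' s - f s)
      (Icc a b) s := fun s hs => (hF s hs).sub (hasDerivWithinAt_integral_Icc hf hs)
  have h := (convex_Icc a b).norm_image_sub_le_of_norm_hasDerivWithin_le hG hC
    (left_mem_Icc.mpr hab) (right_mem_Icc.mpr hab)
  rwa [intervalIntegral.integral_same, sub_zero, Real.norm_of_nonneg (sub_nonneg.mpr hab),
    sub_right_comm] at h

end Integral

variable [InnerProductSpace ℝ E]

lemma norm_le_of_inner_deriv_le {r r' : ℝ → E} {κ : ℝ} (hκ : 0 ≤ κ)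
    (hr : ∀ s ∈ Icc a b, HasDerivWithinAt r (r' s) (Icc a b) s)
    (hrr' : ∀ s ∈ Icc a b, ⟪r s, r' s⟫ ≤ κ * ‖r s‖) {s : ℝ} (hs : s ∈ Icc a b) :
    ‖r s‖ ≤ ‖r a‖ + κ * (s - a) := by
  have fence : ∀ η > 0, ‖r s‖ ≤ ‖r a‖ + κ * (s - a) + η * (1 + (s - a)) := by
    intro η hη
    set β : ℝ → ℝ := fun t => ‖r a‖ + κ * (t - a) + η * (1 + (t - a))
    have hβ_pos : ∀ t, a ≤ t → 0 < β t := fun t ht => by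
      have := sub_nonneg.mpr ht
      positivity
    have hβ : ∀ t, HasDerivAt β (κ + η) t := fun t => by
      have hid : HasDerivAt (fun t : ℝ => t - a) 1 t := (hasDerivAt_id t).sub_const a
      exact (((hid.const_mul κ).const_add ‖r a‖).add ((hid.const_add 1).const_mul η)).congr_deriv
        (by ring)
    have hsq : ‖r s‖ ^ 2 ≤ β s ^ 2 := by
      refine image_le_of_deriv_right_lt_deriv_boundary
        (fun t ht => (hr t ht).norm_sq.continuousWithinAt)
        (fun t ht => (hr t (Ico_subset_Icc_self ht)).norm_sq.mono_of_mem_nhdsWithin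
          (Icc_mem_nhdsGE_of_mem ht))
        ?_ (fun t => (hβ t).pow 2) (fun t ht htβ => ?_) hs
      · exact pow_le_pow_left₀ (norm_nonneg _) (by simp [β, hη.le]) 2
      · have ht' := hβ_pos t ht.1
        have htβ' : ‖r t‖ = β t := (sq_eq_sq₀ (norm_nonneg _) ht'.le).mp htβ
        have := hrr' t (Ico_subset_Icc_self ht)
        rw [htβ'] at this
        norm_num
        nlinarith
    exact (sq_le_sq₀ (norm_nonneg _) (hβ_pos s hs.1).le).mp hsq
  have hpos : 0 < 1 + (s - a) := by linarith [hs.1]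
  refine le_of_forall_pos_le_add fun η hη => ?_
  simpa [div_mul_cancel₀ _ hpos.ne'] using fence (η / (1 + (s - a))) (by positivity)

variable {L : ℝ → E → E} {ρ ρ' P P' B B' Y Y' : ℝ → E} {ε β δ R : ℝ}

-- Since `L B = P'`, the corrected error `r = ρ - P - ε B` satisfies `ε r' = L r - ε² B'`: the
-- correction removes the term of order `ε` from the inhomogeneity.
lemma norm_sub_le_of_dissipative (hε : 0 < ε)
    (hlin : ∀ s ∈ Icc a b, IsLinearMap ℝ (L s)) (hL : ∀ s ∈ Icc a b, ∀ x, ⟪x, L s x⟫ ≤ 0)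
    (hρ : ∀ s ∈ Icc a b, HasDerivWithinAt ρ (ρ' s) (Icc a b) s)
    (hρL : ∀ s ∈ Icc a b, ε • ρ' s = L s (ρ s))
    (hP : ∀ s ∈ Icc a b, HasDerivWithinAt P (P' s) (Icc a b) s)
    (hLP : ∀ s ∈ Icc a b, L s (P s) = 0)
    (hB : ∀ s ∈ Icc a b, HasDerivWithinAt B (B' s) (Icc a b) s)
    (hLB : ∀ s ∈ Icc a b, L s (B s) = P' s)
    (hBβ : ∀ s ∈ Icc a b, ‖B s‖ ≤ β) (hBδ : ∀ s ∈ Icc a b, ‖B' s‖ ≤ δ)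
    (hinit : ρ a = P a) {s : ℝ} (hs : s ∈ Icc a b) :
    ‖ρ s - P s‖ ≤ ε * (2 * β + δ * (b - a)) := by
  have hδ : 0 ≤ δ := (norm_nonneg _).trans (hBδ s hs)
  set r : ℝ → E := fun t => ρ t - P t - ε • B t with hr
  have hr_deriv : ∀ t ∈ Icc a b, HasDerivWithinAt r (ρ' t - P' t - ε • B' t) (Icc a b) t :=
    fun t ht => ((hρ t ht).sub (hP t ht)).sub ((hB t ht).const_smul ε)
  have hLr : ∀ t ∈ Icc a b, L t (r t) = ε • (ρ' t - P' t) := fun t ht => by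
    simp only [hr, (hlin t ht).map_sub, (hlin t ht).map_smul, hLP t ht, hLB t ht, ← hρL t ht,
      sub_zero, smul_sub]
  have hr_diss : ∀ t ∈ Icc a b, ⟪r t, ρ' t - P' t - ε • B' t⟫ ≤ ε * δ * ‖r t‖ := by
    intro t ht
    have hdrift : ⟪r t, ρ' t - P' t⟫ ≤ 0 := by
      refine nonpos_of_mul_nonpos_right ?_ hε
      rw [← real_inner_smul_right, ← hLr t ht]
      exact hL t ht (r t)
    have hforce : -⟪r t, B' t⟫ ≤ ‖r t‖ * δ :=
      ((neg_le_abs _).trans (abs_real_inner_le_norm _ _)).trans (by gcongr; exact hBδ t ht)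
    rw [inner_sub_right, real_inner_smul_right]
    linarith [mul_le_mul_of_nonneg_left hforce hε.le]
  have hεB : ∀ t ∈ Icc a b, ‖ε • B t‖ ≤ ε * β := fun t ht => by
    rw [norm_smul, Real.norm_of_nonneg hε.le]
    gcongr
    exact hBβ t ht
  have hr_init : ‖r a‖ ≤ ε * β := by
    simpa [hr, hinit] using hεB a (left_mem_Icc.mpr (hs.1.trans hs.2))
  calc ‖ρ s - P s‖ = ‖r s + ε • B s‖ := by simp [hr]
    _ ≤ ‖r s‖ + ‖ε • B s‖ := norm_add_le _ _
    _ ≤ (ε * β + ε * δ * (b - a)) + ε * β := by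
      gcongr
      · refine (norm_le_of_inner_deriv_le (by positivity) hr_deriv hr_diss hs).trans ?_
        gcongr
        exact hs.2
      · exact hεB s hs
    _ = ε * (2 * β + δ * (b - a)) := by ring

-- As `⟪P, ρ'⟫ = 0`, the overlap `⟪P, ρ⟫` changes at the rate `⟪P', ρ⟫ = ε ⟪Y, ρ'⟫`, which
-- subtracting `ε ⟪Y, ρ - P⟫` turns into `ε ⟪Y, P'⟫` up to a term of order `ε²`.
lemma abs_inner_sub_sub_integral_le (hab : a ≤ b) (hε : 0 < ε)
    (hρ : ∀ s ∈ Icc a b, HasDerivWithinAt ρ (ρ' s) (Icc a b) s)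
    (hρL : ∀ s ∈ Icc a b, ε • ρ' s = L s (ρ s))
    (hP : ∀ s ∈ Icc a b, HasDerivWithinAt P (P' s) (Icc a b) s)
    (hPL : ∀ s ∈ Icc a b, ∀ x, ⟪P s, L s x⟫ = 0)
    (hY : ∀ s ∈ Icc a b, HasDerivWithinAt Y (Y' s) (Icc a b) s)
    (hYL : ∀ s ∈ Icc a b, ∀ x, ⟪Y s, L s x⟫ = ⟪P' s, x⟫)
    (hYβ : ‖Y b‖ ≤ β) (hYδ : ∀ s ∈ Icc a b, ‖Y' s‖ ≤ δ)
    (hcont : ContinuousOn (fun s => ⟪Y s, P' s⟫) (Icc a b))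
    (hρP : ∀ s ∈ Icc a b, ‖ρ s - P s‖ ≤ ε * R) (hinit : ρ a = P a) :
    |⟪P b, ρ b⟫ - ‖P a‖ ^ 2 - ε * ∫ s in a..b, ⟪Y s, P' s⟫| ≤ (β + δ * (b - a)) * R * ε ^ 2 := by
  have hPρ' : ∀ s ∈ Icc a b, ⟪P s, ρ' s⟫ = 0 := fun s hs => by
    have h := hPL s hs (ρ s)
    rw [← hρL s hs, real_inner_smul_right] at h
    exact (mul_eq_zero.mp h).resolve_left hε.ne'
  have hYρ' : ∀ s ∈ Icc a b, ε * ⟪Y s, ρ' s⟫ = ⟪P' s, ρ s⟫ := fun s hs => by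
    rw [← hYL s hs, ← hρL s hs, real_inner_smul_right]
  have hdist : ∀ s ∈ Icc a b, ∀ {z : E} {c : ℝ}, ‖z‖ ≤ c →
      ‖ε * ⟪z, ρ s - P s⟫‖ ≤ c * R * ε ^ 2 := by
    intro s hs z c hz
    have hc : 0 ≤ c := (norm_nonneg z).trans hz
    calc ‖ε * ⟪z, ρ s - P s⟫‖ = ε * ‖⟪z, ρ s - P s⟫‖ := by
          rw [norm_mul, Real.norm_of_nonneg hε.le]
      _ ≤ ε * (c * (ε * R)) := by
        gcongr
        exact (norm_inner_le_norm _ _).trans (by gcongr; exact hρP s hs)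
      _ = c * R * ε ^ 2 := by ring
  set F : ℝ → ℝ := fun s => ⟪P s, ρ s⟫ - ε * ⟪Y s, ρ s - P s⟫ with hF
  have hF_deriv : ∀ s ∈ Icc a b,
      HasDerivWithinAt F (ε * ⟪Y s, P' s⟫ - ε * ⟪Y' s, ρ s - P s⟫) (Icc a b) s := by
    intro s hs
    refine (((hP s hs).inner ℝ (hρ s hs)).sub
      (((hY s hs).inner ℝ ((hρ s hs).sub (hP s hs))).const_mul ε)).congr_deriv ?_
    rw [hPρ' s hs, ← hYρ' s hs, inner_sub_right (Y s), Pi.sub_apply]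
    ring
  have hmain := norm_sub_sub_integral_le hab hF_deriv (hcont.const_mul ε) (C := δ * R * ε ^ 2)
    fun s hs => by
      rw [sub_sub_cancel_left, norm_neg]
      exact hdist s hs (hYδ s hs)
  have hsplit : ⟪P b, ρ b⟫ - ‖P a‖ ^ 2 - ε * ∫ s in a..b, ⟪Y s, P' s⟫ =
      (F b - F a - ∫ s in a..b, ε * ⟪Y s, P' s⟫) + ε * ⟪Y b, ρ b - P b⟫ := by
    simp only [hF, hinit, sub_self, inner_zero_right, real_inner_self_eq_norm_sq,
      intervalIntegral.integral_const_mul]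
    ring
  rw [hsplit, ← Real.norm_eq_abs]
  calc _ ≤ δ * R * ε ^ 2 * (b - a) + β * R * ε ^ 2 :=
        norm_add_le_of_le hmain (hdist b (right_mem_Icc.mpr hab) hYβ)
    _ = (β + δ * (b - a)) * R * ε ^ 2 := by ring

end DissipativeEvolution


section OffDiagonal

variable {ι R : Type*} [Ring R] {P : ι → R} {X : R} {a j k : ι}

lemma mul_mul_eq_zero_of_eq_add (hP : OrthogonalIdempotents P) (hX : X = P a * X + X * P a)
    (hjk : j = a ↔ k = a) : P j * X * P k = 0 := by
  classical
  have hexpand : P j * X * P k = P j * P a * X * P k + P j * X * (P a * P k) := by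
    conv_lhs => rw [hX]
    simp only [mul_add, add_mul, mul_assoc]
  rw [hP.mul_eq, hP.mul_eq] at hexpand
  by_cases hj : j = a
  · obtain rfl := hj
    obtain rfl := hjk.mp rfl
    simpa using hexpand
  · simpa [hj, Ne.symm (fun hk => hj (hjk.mpr hk))] using hexpand

lemma mul_mul_eq_mul_of_eq_add (hP : OrthogonalIdempotents P) (hX : X = P a * X + X * P a)
    (hj : j ≠ a) : P j * X * P a = P j * X := by
  conv_rhs => rw [hX, mul_add, ← mul_assoc, hP.ortho hj, zero_mul, zero_add, ← mul_assoc]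

end OffDiagonal

section SchurMultiplier

variable {ι 𝕜 R : Type*} [Fintype ι] [CommRing 𝕜] [Ring R] [Algebra 𝕜 R] {P : ι → R}

/-- The Schur multiplier `X ↦ ∑ j k, c j k P_j X P_k` with symbol `c`, for the block decomposition
given by a family `P` of idempotents. -/
noncomputable def schurMul (P : ι → R) (c : ι → ι → 𝕜) : R →ₗ[𝕜] R :=
  ∑ j, ∑ k, c j k • LinearMap.mulLeftRight 𝕜 (P j, P k)

lemma schurMul_apply (c : ι → ι → 𝕜) (X : R) :
    schurMul P c X = ∑ j, ∑ k, c j k • (P j * X * P k) := by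
  simp only [schurMul, LinearMap.sum_apply, LinearMap.smul_apply, LinearMap.mulLeftRight_apply]

lemma mul_schurMul_mul (hP : OrthogonalIdempotents P) (c : ι → ι → 𝕜) (X : R) (j k : ι) :
    P j * schurMul P c X * P k = c j k • (P j * X * P k) := by
  classical
  have hterm : ∀ j' k', P j * (c j' k' • (P j' * X * P k')) * P k =
      c j' k' • (P j * P j' * X * (P k' * P k)) := fun j' k' => by
    simp only [mul_smul_comm, smul_mul_assoc, mul_assoc]
  simp only [schurMul_apply, Finset.mul_sum, Finset.sum_mul, hterm, hP.mul_eq, ite_mul, mul_ite,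
    zero_mul, mul_zero, smul_ite, smul_zero, Finset.sum_ite_eq, Finset.sum_ite_eq',
    Finset.mem_univ, if_true]

lemma schurMul_schurMul (hP : OrthogonalIdempotents P) (c d : ι → ι → 𝕜) (X : R) :
    schurMul P c (schurMul P d X) = schurMul P (c * d) X := by
  simp only [schurMul_apply (c := c), schurMul_apply (c := c * d), mul_schurMul_mul hP, smul_smul,
    Pi.mul_apply]

lemma schurMul_eq_self (hP : CompleteOrthogonalIdempotents P) {c : ι → ι → 𝕜} {X : R}
    (h : ∀ j k, c j k = 1 ∨ P j * X * P k = 0) : schurMul P c X = X := by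
  have hterm : ∀ j k, c j k • (P j * X * P k) = P j * X * P k := fun j k => by
    rcases h j k with h | h <;> simp [h]
  simp only [schurMul_apply, hterm, ← Finset.mul_sum, ← Finset.sum_mul, hP.complete, one_mul,
    mul_one]

lemma schurMul_apply_idempotent (hP : OrthogonalIdempotents P) (c : ι → ι → 𝕜) (a : ι) :
    schurMul P c (P a) = c a a • P a := by
  classical
  simp only [schurMul_apply, hP.mul_eq, ite_mul, zero_mul, smul_ite, smul_zero,
    Finset.sum_ite_irrel, Finset.sum_const_zero, Finset.sum_ite_eq, Finset.sum_ite_eq',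
    Finset.mem_univ, if_true]

lemma mul_eq_sum_smul (hP : CompleteOrthogonalIdempotents P) {A : R} {e : ι → 𝕜}
    (hA : ∀ j, A * P j = e j • P j) (X : R) : A * X = ∑ j, ∑ k, e j • (P j * X * P k) := by
  simp only [← Finset.mul_sum, hP.complete, mul_one, ← smul_mul_assoc, ← hA, ← Finset.sum_mul]

lemma mul_eq_sum_smul' (hP : CompleteOrthogonalIdempotents P) {A : R} {e : ι → 𝕜}
    (hA : ∀ k, P k * A = e k • P k) (X : R) : X * A = ∑ j, ∑ k, e k • (P j * X * P k) := by
  simp only [← mul_smul_comm, ← hA, ← Finset.mul_sum, ← Finset.sum_mul, hP.complete, one_mul]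

end SchurMultiplier

section FrobeniusInner

open scoped RealInnerProductSpace

variable {m n ι 𝕜 : Type*} [Fintype m] [Fintype n] [RCLike 𝕜]

lemma trace_conjTranspose_mul_self (A : Matrix m n 𝕜) : (Aᴴ * A).trace = ((‖A‖ ^ 2 : ℝ) : 𝕜) := by
  have hnorm : ‖A‖ ^ 2 = ∑ i, ∑ j, ‖A i j‖ ^ 2 := by
    have hnonneg : 0 ≤ ∑ i, ∑ j, ‖A i j‖ ^ (2 : ℝ) := by positivity
    rw [Matrix.frobenius_norm_def, ← Real.sqrt_eq_rpow, Real.sq_sqrt hnonneg]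
    simp only [Real.rpow_two]
  rw [hnorm, Finset.sum_comm]
  simp [Matrix.trace, Matrix.mul_apply, RCLike.conj_mul]

/-- The real inner product `⟪A, B⟫ = Re tr (Aᴴ B)`, which induces the Frobenius norm. -/
noncomputable instance frobeniusInnerProductSpace : InnerProductSpace ℝ (Matrix m n 𝕜) where
  inner A B := RCLike.re (Aᴴ * B).trace
  norm_sq_eq_re_inner A := by
    rw [trace_conjTranspose_mul_self, RCLike.ofReal_re, RCLike.re_to_real]
  conj_inner_symm A B := by
    rw [← Matrix.conjTranspose_conjTranspose A, ← Matrix.conjTranspose_mul,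
      Matrix.trace_conjTranspose]
    simp
  add_left A B C := by simp [Matrix.add_mul]
  smul_left A B r := by simp [RCLike.smul_re]

lemma frobenius_inner_def (A B : Matrix m n 𝕜) : ⟪A, B⟫ = RCLike.re (Aᴴ * B).trace := rfl

lemma frobenius_inner_smul_self (c : 𝕜) (A : Matrix m n 𝕜) :
    ⟪A, c • A⟫ = RCLike.re c * ‖A‖ ^ 2 := by
  rw [frobenius_inner_def, Matrix.mul_smul, Matrix.trace_smul, trace_conjTranspose_mul_self,
    smul_eq_mul, RCLike.re_mul_ofReal]

lemma frobenius_inner_smul_mul_mul {A : Matrix m m 𝕜} {B : Matrix n n 𝕜} (hA : A.IsHermitian)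
    (hB : B.IsHermitian) (c : 𝕜) (X Y : Matrix m n 𝕜) :
    ⟪X, c • (A * Y * B)⟫ = ⟪star c • (A * X * B), Y⟫ := by
  simp only [frobenius_inner_def, Matrix.conjTranspose_smul, Matrix.conjTranspose_mul, hA.eq,
    hB.eq, star_star, Matrix.mul_smul, Matrix.smul_mul, Matrix.trace_smul]
  rw [← Matrix.mul_assoc, Matrix.trace_mul_comm]
  simp only [Matrix.mul_assoc]

variable [DecidableEq n] {P : ι → Matrix n n 𝕜} {c : ι → ι → 𝕜} {X : Matrix n n 𝕜} {a : ι}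

lemma norm_mul_mul_sq_eq_re_trace (hP : OrthogonalIdempotents P)
    (hPherm : ∀ j, (P j).IsHermitian) (hXherm : X.IsHermitian) (hX : X = P a * X + X * P a)
    {j : ι} (hj : j ≠ a) : ‖P j * X * P a‖ ^ 2 = RCLike.re (P j * X ^ 2).trace := by
  rw [mul_mul_eq_mul_of_eq_add hP hX hj, ← real_inner_self_eq_norm_sq, frobenius_inner_def,
    Matrix.conjTranspose_mul, (hPherm j).eq, hXherm.eq, mul_assoc, ← mul_assoc (P j) (P j),
    (hP.idem j).eq, Matrix.trace_mul_comm, mul_assoc, sq]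

variable [Fintype ι]

lemma inner_schurMul_right (hPherm : ∀ j, (P j).IsHermitian) (X Y : Matrix n n 𝕜) :
    ⟪X, schurMul P c Y⟫ = ⟪schurMul P (star c) X, Y⟫ := by
  simp only [schurMul_apply, inner_sum, sum_inner, Pi.star_apply,
    frobenius_inner_smul_mul_mul (hPherm _) (hPherm _)]

lemma inner_self_schurMul (hP : OrthogonalIdempotents P) (hPherm : ∀ j, (P j).IsHermitian) :
    ⟪X, schurMul P c X⟫ = ∑ j, ∑ k, RCLike.re (c j k) * ‖P j * X * P k‖ ^ 2 := by
  simp only [schurMul_apply, inner_sum]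
  refine Finset.sum_congr rfl fun j _ => Finset.sum_congr rfl fun k _ => ?_
  have hblock : P j * X * P k = P j * (P j * X * P k) * P k := by
    simp only [← mul_assoc, (hP.idem j).eq]
    rw [mul_assoc _ (P k), (hP.idem k).eq]
  rw [hblock, frobenius_inner_smul_mul_mul (hPherm j) (hPherm k), real_inner_comm, ← hblock,
    frobenius_inner_smul_self, RCLike.star_def, RCLike.conj_re]

lemma inner_self_schurMul_nonpos (hP : OrthogonalIdempotents P)
    (hPherm : ∀ j, (P j).IsHermitian) (hc : ∀ j k, RCLike.re (c j k) ≤ 0) :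
    ⟪X, schurMul P c X⟫ ≤ 0 := by
  rw [inner_self_schurMul hP hPherm]
  exact Finset.sum_nonpos fun j _ => Finset.sum_nonpos fun k _ =>
    mul_nonpos_of_nonpos_of_nonneg (hc j k) (sq_nonneg _)

lemma inner_self_schurMul_of_eq_add [DecidableEq ι] (hP : OrthogonalIdempotents P)
    (hPherm : ∀ j, (P j).IsHermitian) (hXherm : X.IsHermitian) (hX : X = P a * X + X * P a) :
    ⟪X, schurMul P c X⟫ = ∑ j ∈ Finset.univ.filter (· ≠ a),
      (RCLike.re (c j a) + RCLike.re (c a j)) * RCLike.re (P j * X ^ 2).trace := by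
  have hzero : ∀ j k, (j = a ↔ k = a) → RCLike.re (c j k) * ‖P j * X * P k‖ ^ 2 = 0 :=
    fun j k hjk => by simp [mul_mul_eq_zero_of_eq_add hP hX hjk]
  have hswap : ∀ j, ‖P a * X * P j‖ = ‖P j * X * P a‖ := fun j => by
    rw [← Matrix.frobenius_norm_conjTranspose, Matrix.conjTranspose_mul, Matrix.conjTranspose_mul,
      (hPherm a).eq, (hPherm j).eq, hXherm.eq, mul_assoc]
  rw [inner_self_schurMul hP hPherm, ← Finset.sum_erase_add _ _ (Finset.mem_univ a),
    ← Finset.sum_erase (a := a) Finset.univ (hzero a a Iff.rfl), ← Finset.sum_add_distrib,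
    Finset.filter_ne']
  refine Finset.sum_congr rfl fun j hj => ?_
  have hja : j ≠ a := Finset.ne_of_mem_erase hj
  rw [Fintype.sum_eq_single a fun k hk => hzero j k (iff_of_false hja hk), hswap,
    norm_mul_mul_sq_eq_re_trace hP hPherm hXherm hX hja, add_mul]

end FrobeniusInner

section Spectrum

variable {N : ℕ} {A : Matrix (Fin N) (Fin N) ℂ}

/-- The gap condition: `A` is self-adjoint and its `N` eigenvalues are pairwise distinct. -/
structure HasSimpleSpectrum (A : Matrix (Fin N) (Fin N) ℂ) : Prop where
  isHermitian : A.IsHermitian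
  injective_energy : Function.Injective (energy A)

lemma monotone_energy (A : Matrix (Fin N) (Fin N) ℂ) : Monotone (energy A) := by
  intro a b hab
  unfold energy
  split_ifs with hA
  · apply hA.eigenvalues₀_antitone
    simpa [Fin.le_def] using Fin.rev_le_rev.mpr hab
  · exact le_rfl

lemma HasSimpleSpectrum.strictMono_energy (hA : HasSimpleSpectrum A) : StrictMono (energy A) :=
  (monotone_energy A).strictMono_of_injective hA.injective_energy

lemma exists_perm_eigenvalues_eq (hA : A.IsHermitian) :
    ∃ σ : Equiv.Perm (Fin N), hA.eigenvalues = energy A ∘ σ := by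
  refine ⟨((Fintype.equivOfCardEq (Fintype.card_fin _)).symm.trans
    (finCongr (Fintype.card_fin N))).trans Fin.revPerm, funext fun i => ?_⟩
  simp [energy, hA, Matrix.IsHermitian.eigenvalues]

lemma spectrum_eq_range_energy (hA : A.IsHermitian) : spectrum ℝ A = range (energy A) := by
  obtain ⟨σ, hσ⟩ := exists_perm_eigenvalues_eq hA
  rw [hA.spectrum_real_eq_range_eigenvalues, hσ, σ.surjective.range_comp]

lemma energy_eq_of_strictMono (hA : A.IsHermitian) {f : Fin N → ℝ} (hf : StrictMono f)
    (hmem : ∀ a, f a ∈ spectrum ℝ A) : energy A = f := by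
  rw [spectrum_eq_range_energy hA] at hmem
  choose g hg using hmem
  have hg_mono : StrictMono g := fun a b hab =>
    (monotone_energy A).reflect_lt (by rw [hg, hg]; exact hf hab)
  have hg_id : g = id := hg_mono.range_inj strictMono_id |>.mp (by
    rw [(Finite.injective_iff_surjective.mp hg_mono.injective).range_eq, range_id])
  funext a
  rw [← hg a, hg_id, id]

lemma specProj_eq_cfc (hA : A.IsHermitian) (a : Fin N) :
    specProj A a = cfc (fun x : ℝ => if x = energy A a then 1 else 0) A := by
  rw [hA.cfc_eq]
  simp only [specProj, hA, dif_pos]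

lemma cfc_eq_cfc_of_eq_energy (hA : A.IsHermitian) {f g : ℝ → ℝ}
    (h : ∀ a, f (energy A a) = g (energy A a)) : cfc f A = cfc g A :=
  cfc_congr fun x hx => by
    obtain ⟨a, rfl⟩ := spectrum_eq_range_energy hA ▸ hx
    exact h a

lemma continuousOn_spectrum (f : ℝ → ℝ) (A : Matrix (Fin N) (Fin N) ℂ) :
    ContinuousOn f (spectrum ℝ A) :=
  A.finite_real_spectrum.continuousOn f

lemma isHermitian_specProj (hA : A.IsHermitian) (a : Fin N) : (specProj A a).IsHermitian := by
  rw [specProj_eq_cfc hA]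
  exact cfc_predicate _ A

lemma mul_specProj (hA : A.IsHermitian) (a : Fin N) :
    A * specProj A a = (energy A a : ℂ) • specProj A a := by
  have hA' : IsSelfAdjoint A := hA
  rw [specProj_eq_cfc hA, Complex.coe_smul,
    ← cfc_smul _ _ A (continuousOn_spectrum _ A)]
  nth_rewrite 1 [← cfc_id' ℝ A hA']
  rw [← cfc_mul _ _ A (continuousOn_spectrum _ A) (continuousOn_spectrum _ A)]
  congr! 2 with x
  split_ifs with h <;> simp [h]

lemma specProj_mul (hA : A.IsHermitian) (a : Fin N) :
    specProj A a * A = (energy A a : ℂ) • specProj A a := by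
  simpa [(isHermitian_specProj hA a).eq, hA.eq] using
    congrArg Matrix.conjTranspose (mul_specProj hA a)

lemma HasSimpleSpectrum.completeOrthogonalIdempotents_specProj (hA : HasSimpleSpectrum A) :
    CompleteOrthogonalIdempotents (specProj A) := by
  refine CompleteOrthogonalIdempotents.iff_ortho_complete.mpr ⟨fun a b hab => ?_, ?_⟩
  · beta_reduce
    rw [specProj_eq_cfc hA.isHermitian, specProj_eq_cfc hA.isHermitian,
      ← cfc_mul _ _ A (continuousOn_spectrum _ A) (continuousOn_spectrum _ A),
      ← cfc_const_zero ℝ A]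
    refine cfc_eq_cfc_of_eq_energy hA.isHermitian fun c => ?_
    by_cases hc : c = a
    · simp [hc, hA.injective_energy.eq_iff, hab]
    · simp [hA.injective_energy.eq_iff, hc]
  · have hA' : IsSelfAdjoint A := hA.isHermitian
    simp_rw [specProj_eq_cfc hA.isHermitian]
    rw [← cfc_sum_univ _ A (fun i => continuousOn_spectrum _ A), ← cfc_one ℝ A hA']
    refine cfc_eq_cfc_of_eq_energy hA.isHermitian fun c => ?_
    simp [hA.injective_energy.eq_iff]

lemma HasSimpleSpectrum.trace_specProj (hA : HasSimpleSpectrum A) (a : Fin N) :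
    (specProj A a).trace = 1 := by
  obtain ⟨σ, hσ⟩ := exists_perm_eigenvalues_eq hA.isHermitian
  rw [specProj_eq_cfc hA.isHermitian, hA.isHermitian.cfc_eq, Matrix.IsHermitian.cfc,
    Unitary.conjStarAlgAut_apply, Matrix.trace_mul_cycle]
  simp [hσ, hA.injective_energy.eq_iff, ← σ.eq_symm_apply, ← Complex.ofReal_sum]

lemma HasSimpleSpectrum.specProj_eq_aeval_basis (hA : HasSimpleSpectrum A) (a : Fin N) :
    specProj A a = Polynomial.aeval A (Lagrange.basis Finset.univ (energy A) a) := by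
  have hA' : IsSelfAdjoint A := hA.isHermitian
  rw [specProj_eq_cfc hA.isHermitian, ← cfc_polynomial _ A hA']
  refine cfc_eq_cfc_of_eq_energy hA.isHermitian fun b => ?_
  by_cases h : b = a
  · simp [h, Lagrange.eval_basis_self hA.injective_energy.injOn (Finset.mem_univ a)]
  · simp [hA.injective_energy.eq_iff, h,
      Lagrange.eval_basis_of_ne (Ne.symm h) (Finset.mem_univ b)]

end Spectrum

section Smoothness

variable {N : ℕ} {A : Matrix (Fin N) (Fin N) ℂ} {n : WithTop ℕ∞}

/-- The characteristic polynomial `det (t - A)` as a real function of the pair `(A, t)`. -/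
noncomputable def reCharpoly (p : Matrix (Fin N) (Fin N) ℂ × ℝ) : ℝ :=
  (p.1.charpoly.eval (p.2 : ℂ)).re

lemma contDiff_det {m 𝕜 : Type*} [Fintype m] [DecidableEq m] [NontriviallyNormedField 𝕜]
    [CompleteSpace 𝕜] : ContDiff 𝕜 n fun A : Matrix m m 𝕜 => A.det := by
  have hentry : ∀ i j, ContDiff 𝕜 n fun A : Matrix m m 𝕜 => A i j := fun i j =>
    (Matrix.entryLinearMap 𝕜 𝕜 i j).toContinuousLinearMap.contDiff
  simp_rw [Matrix.det_apply]
  exact ContDiff.sum fun σ _ => (contDiff_prod fun i _ => hentry (σ i) i).const_smul _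

lemma contDiff_reCharpoly :
    ContDiff ℝ n (reCharpoly : Matrix (Fin N) (Fin N) ℂ × ℝ → ℝ) := by
  have hscalar : ContDiff ℝ n fun p : Matrix (Fin N) (Fin N) ℂ × ℝ =>
      (p.2 : ℂ) • (1 : Matrix (Fin N) (Fin N) ℂ) - p.1 :=
    ((Complex.ofRealCLM.contDiff.comp contDiff_snd).smul contDiff_const).sub contDiff_fst
  unfold reCharpoly
  simp_rw [Matrix.eval_charpoly, Matrix.scalar_apply, ← Matrix.smul_one_eq_diagonal]
  exact Complex.reCLM.contDiff.comp ((contDiff_det.restrict_scalars ℝ).comp hscalar)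

lemma reCharpoly_eq_prod (hA : A.IsHermitian) (t : ℝ) :
    reCharpoly (A, t) = ∏ a, (t - energy A a) := by
  obtain ⟨σ, hσ⟩ := exists_perm_eigenvalues_eq hA
  rw [reCharpoly, hA.charpoly_eq, hσ, ← Equiv.prod_comp σ fun a => t - energy A a]
  simp [Polynomial.eval_prod, ← Complex.ofReal_sub, ← Complex.ofReal_prod]

lemma reCharpoly_eq_zero_iff (hA : A.IsHermitian) {t : ℝ} :
    reCharpoly (A, t) = 0 ↔ t ∈ spectrum ℝ A := by
  rw [reCharpoly_eq_prod hA, Finset.prod_eq_zero_iff, spectrum_eq_range_energy hA]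
  simp [sub_eq_zero, eq_comm]

lemma exists_hasDerivAt_prod_sub {ι 𝕜 : Type*} [Fintype ι] [NontriviallyNormedField 𝕜]
    {e : ι → 𝕜} (he : Function.Injective e) (i : ι) :
    ∃ c ≠ 0, HasDerivAt (fun t => ∏ j, (t - e j)) c (e i) := by
  set p : Polynomial 𝕜 := ∏ j, (Polynomial.X - Polynomial.C (e j)) with hp
  have hsep : p.Separable := Polynomial.separable_prod_X_sub_C_iff.mpr he
  have heval : ∀ t, p.eval t = ∏ j, (t - e j) := fun t => by simp [hp, Polynomial.eval_prod]
  refine ⟨p.derivative.eval (e i), hsep.aeval_derivative_ne_zero ?_, ?_⟩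
  · rw [Polynomial.coe_aeval_eq_eval, heval]
    exact Finset.prod_eq_zero (Finset.mem_univ i) (sub_self _)
  · simpa only [heval] using p.hasDerivAt (e i)

lemma HasSimpleSpectrum.isInvertible_fderiv_reCharpoly (hA : HasSimpleSpectrum A) (a : Fin N) :
    (fderiv ℝ reCharpoly (A, energy A a) ∘L
      .inr ℝ (Matrix (Fin N) (Fin N) ℂ) ℝ).IsInvertible := by
  obtain ⟨c, hc, hderiv⟩ := exists_hasDerivAt_prod_sub hA.injective_energy a
  have hdiff : DifferentiableAt ℝ reCharpoly (A, energy A a) :=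
    (contDiff_reCharpoly (n := 1)).differentiable one_ne_zero _
  have hpartial : HasDerivAt (fun t => reCharpoly (A, t))
      (fderiv ℝ reCharpoly (A, energy A a) (0, 1)) (energy A a) :=
    hdiff.hasFDerivAt.comp_hasDerivAt _ ((hasDerivAt_const _ A).prodMk (hasDerivAt_id _))
  simp_rw [reCharpoly_eq_prod hA.isHermitian] at hpartial
  refine ⟨ContinuousLinearEquiv.smulLeft (Units.mk0 c hc), ?_⟩
  ext
  simp [hpartial.unique hderiv]

-- The implicit function theorem continues each simple root `e_a` of the characteristic polynomial;
-- near `A` the roots found this way stay ordered, hence they are all the eigenvalues.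
lemma HasSimpleSpectrum.exists_contDiffAt_energy (hA : HasSimpleSpectrum A) (hn : n ≠ 0) :
    ∃ f : Fin N → Matrix (Fin N) (Fin N) ℂ → ℝ, (∀ a, ContDiffAt ℝ n (f a) A) ∧
      ∀ᶠ B in nhds A, B.IsHermitian → ∀ a, energy B a = f a B := by
  have hchar : ∀ a, ContDiffAt ℝ n reCharpoly (A, energy A a) := fun a =>
    contDiff_reCharpoly.contDiffAt
  have hinv := hA.isInvertible_fderiv_reCharpoly
  set f : Fin N → Matrix (Fin N) (Fin N) ℂ → ℝ := fun a =>
    (hchar a).implicitFunction hn (hinv a)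
  have hfA : ∀ a, f a A = energy A a := fun a =>
    (hchar a).implicitFunction_apply_self hn (hinv a)
  have hf : ∀ a, ContDiffAt ℝ n (f a) A := fun a =>
    (hchar a).contDiffAt_implicitFunction hn (hinv a)
  have hroot : ∀ᶠ B in nhds A, ∀ a, reCharpoly (B, f a B) = 0 := by
    refine Filter.eventually_all.mpr fun a => ?_
    filter_upwards [(hchar a).eventually_apply_implicitFunction hn (hinv a)] with B hB
    rw [hB, reCharpoly_eq_zero_iff hA.isHermitian, spectrum_eq_range_energy hA.isHermitian]
    exact mem_range_self a
  have hlt : ∀ᶠ B in nhds A, ∀ a b, a < b → f a B < f b B := by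
    refine Filter.eventually_all.mpr fun a => Filter.eventually_all.mpr fun b =>
      Filter.eventually_imp_distrib_left.mpr fun hab => ?_
    refine (hf a).continuousAt.eventually_lt (hf b).continuousAt ?_
    rw [hfA, hfA]
    exact hA.strictMono_energy hab
  refine ⟨f, hf, ?_⟩
  filter_upwards [hroot, hlt] with B hB_root hB_lt hB a
  rw [energy_eq_of_strictMono hB (fun a b => hB_lt a b)
    fun a => (reCharpoly_eq_zero_iff hB).mp (hB_root a)]

variable {E : Type*} [NormedAddCommGroup E] [NormedSpace ℝ E]
  {H : E → Matrix (Fin N) (Fin N) ℂ} {s : Set E}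

lemma contDiffOn_energy (hH : ContDiffOn ℝ n H s) (hn : n ≠ 0)
    (hsimple : ∀ x ∈ s, HasSimpleSpectrum (H x)) (a : Fin N) :
    ContDiffOn ℝ n (fun x => energy (H x) a) s := by
  intro x hx
  obtain ⟨f, hf, hfB⟩ := (hsimple x hx).exists_contDiffAt_energy hn
  refine ((hf a).comp_contDiffWithinAt x (hH x hx)).congr_of_eventuallyEq ?_
    (hfB.self_of_nhds (hsimple x hx).isHermitian a)
  filter_upwards [(hH x hx).continuousWithinAt.eventually hfB, self_mem_nhdsWithin] with y hy hys
  exact hy (hsimple y hys).isHermitian a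

lemma contDiffOn_specProj (hH : ContDiffOn ℝ n H s) (hn : n ≠ 0)
    (hsimple : ∀ x ∈ s, HasSimpleSpectrum (H x)) (a : Fin N) :
    ContDiffOn ℝ n (fun x => specProj (H x) a) s := by
  have hfactor : ∀ b ≠ a, ContDiffOn ℝ n (fun x => Polynomial.aeval (H x)
      (Lagrange.basisDivisor (energy (H x) a) (energy (H x) b))) s := by
    intro b hb
    have hgap : ContDiffOn ℝ n (fun x => (energy (H x) a - energy (H x) b)⁻¹) s :=
      ((contDiffOn_energy hH hn hsimple a).sub (contDiffOn_energy hH hn hsimple b)).inv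
        fun x hx h => hb ((hsimple x hx).injective_energy (sub_eq_zero.mp h)).symm
    refine (hgap.smul (hH.sub ((contDiffOn_energy hH hn hsimple b).smul
      (contDiffOn_const (c := (1 : Matrix (Fin N) (Fin N) ℂ)))))).congr fun x _ => ?_
    simp [Lagrange.basisDivisor, Algebra.smul_def]
  have hprod : ∀ t : Finset (Fin N), a ∉ t → ContDiffOn ℝ n (fun x => Polynomial.aeval (H x)
      (∏ b ∈ t, Lagrange.basisDivisor (energy (H x) a) (energy (H x) b))) s := by
    intro t
    induction t using Finset.induction_on with
    | empty => simpa using contDiffOn_const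
    | insert b t hb ih =>
      intro ha
      rw [Finset.mem_insert, not_or] at ha
      simpa only [Finset.prod_insert hb, map_mul] using (hfactor b (Ne.symm ha.1)).mul (ih ha.2)
  exact (hprod _ (Finset.notMem_erase a _)).congr fun x hx =>
    (hsimple x hx).specProj_eq_aeval_basis a

end Smoothness

section Lindbladian

open scoped RealInnerProductSpace

variable {N : ℕ} {A X : Matrix (Fin N) (Fin N) ℂ} {g : ℝ} {j k : Fin N}

/-- The eigenvalue of the dephasing Lindbladian on the block `P_j X P_k`. -/
noncomputable def rate (A : Matrix (Fin N) (Fin N) ℂ) (g : ℝ) (j k : Fin N) : ℂ :=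
  -Complex.I * (energy A j - energy A k) - if j ≠ k then (g : ℂ) else 0

lemma rate_self (A : Matrix (Fin N) (Fin N) ℂ) (g : ℝ) (j : Fin N) : rate A g j j = 0 := by
  simp [rate]

lemma re_rate (hjk : j ≠ k) : (rate A g j k).re = -g := by
  simp [rate, hjk]

lemma im_rate : (rate A g j k).im = energy A k - energy A j := by
  by_cases hjk : j = k <;> simp [rate, hjk]

lemma HasSimpleSpectrum.rate_ne_zero (hA : HasSimpleSpectrum A) (g : ℝ) (hjk : j ≠ k) :
    rate A g j k ≠ 0 := fun h =>
  hjk (hA.injective_energy (sub_eq_zero.mp (im_rate.symm.trans (congrArg Complex.im h))).symm)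

lemma re_rate_nonpos (hg : 0 ≤ g) : (rate A g j k).re ≤ 0 := by
  by_cases hjk : j = k
  · simp [hjk, rate_self]
  · simpa [re_rate hjk] using hg

lemma re_inv_rate_nonpos (hg : 0 ≤ g) : ((rate A g)⁻¹ j k).re ≤ 0 := by
  rw [Pi.inv_apply, Pi.inv_apply, Complex.inv_re]
  exact div_nonpos_of_nonpos_of_nonneg (re_rate_nonpos hg) (Complex.normSq_nonneg _)

lemma re_inv_rate (hjk : j ≠ k) :
    ((rate A g)⁻¹ j k).re = -(g / ((energy A j - energy A k) ^ 2 + g ^ 2)) := by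
  rw [Pi.inv_apply, Pi.inv_apply, Complex.inv_re, Complex.normSq_apply, re_rate hjk, im_rate,
    neg_div]
  congr 2
  ring

lemma HasSimpleSpectrum.lindbladian_eq_schurMul (hA : HasSimpleSpectrum A) (g : ℝ) :
    lindbladian A g = schurMul (specProj A) (rate A g) := by
  have hP := hA.completeOrthogonalIdempotents_specProj
  funext ρ
  rw [lindbladian, mul_eq_sum_smul hP (mul_specProj hA.isHermitian),
    mul_eq_sum_smul' hP (specProj_mul hA.isHermitian), schurMul_apply]
  simp only [← Finset.sum_sub_distrib, Finset.smul_sum]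
  refine Finset.sum_congr rfl fun j _ => Finset.sum_congr rfl fun k _ => ?_
  rw [rate]
  split_ifs <;> module

lemma HasSimpleSpectrum.isLinearMap_lindbladian (hA : HasSimpleSpectrum A) (g : ℝ) :
    IsLinearMap ℝ (lindbladian A g) := by
  rw [hA.lindbladian_eq_schurMul]
  exact ((schurMul (specProj A) (rate A g)).restrictScalars ℝ).isLinear

lemma HasSimpleSpectrum.lindbladian_specProj (hA : HasSimpleSpectrum A) (g : ℝ) (a : Fin N) :
    lindbladian A g (specProj A a) = 0 := by
  rw [hA.lindbladian_eq_schurMul, schurMul_apply_idempotent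
    hA.completeOrthogonalIdempotents_specProj.toOrthogonalIdempotents, rate_self, zero_smul]

lemma HasSimpleSpectrum.inner_specProj_lindbladian (hA : HasSimpleSpectrum A) (g : ℝ) (a : Fin N)
    (X : Matrix (Fin N) (Fin N) ℂ) : ⟪specProj A a, lindbladian A g X⟫ = 0 := by
  rw [hA.lindbladian_eq_schurMul, inner_schurMul_right (isHermitian_specProj hA.isHermitian),
    schurMul_apply_idempotent hA.completeOrthogonalIdempotents_specProj.toOrthogonalIdempotents,
    Pi.star_apply, Pi.star_apply, rate_self, star_zero, zero_smul, inner_zero_left]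

lemma HasSimpleSpectrum.inner_self_lindbladian_nonpos (hA : HasSimpleSpectrum A) (hg : 0 ≤ g)
    (X : Matrix (Fin N) (Fin N) ℂ) : ⟪X, lindbladian A g X⟫ ≤ 0 := by
  rw [hA.lindbladian_eq_schurMul]
  exact inner_self_schurMul_nonpos
    hA.completeOrthogonalIdempotents_specProj.toOrthogonalIdempotents
    (isHermitian_specProj hA.isHermitian) fun _ _ => re_rate_nonpos hg

/-- The inverse of the Lindbladian on the matrices with vanishing diagonal blocks `P_j X P_j`; the
junk value `0⁻¹ = 0` makes it vanish on the diagonal blocks. -/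
noncomputable def lindbladianInv (A : Matrix (Fin N) (Fin N) ℂ) (g : ℝ) :
    Matrix (Fin N) (Fin N) ℂ →ₗ[ℂ] Matrix (Fin N) (Fin N) ℂ :=
  schurMul (specProj A) (rate A g)⁻¹

/-- The adjoint of `lindbladianInv` for the Frobenius inner product. -/
noncomputable def lindbladianInvAdj (A : Matrix (Fin N) (Fin N) ℂ) (g : ℝ) :
    Matrix (Fin N) (Fin N) ℂ →ₗ[ℂ] Matrix (Fin N) (Fin N) ℂ :=
  schurMul (specProj A) (star (rate A g)⁻¹)

lemma HasSimpleSpectrum.lindbladian_lindbladianInv (hA : HasSimpleSpectrum A) (g : ℝ)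
    (hX : ∀ j, specProj A j * X * specProj A j = 0) :
    lindbladian A g (lindbladianInv A g X) = X := by
  have hP := hA.completeOrthogonalIdempotents_specProj
  rw [hA.lindbladian_eq_schurMul, lindbladianInv, schurMul_schurMul hP.toOrthogonalIdempotents]
  refine schurMul_eq_self hP fun j k => ?_
  obtain rfl | hjk := eq_or_ne j k
  · exact Or.inr (hX j)
  · exact Or.inl (mul_inv_cancel₀ (hA.rate_ne_zero g hjk))

lemma HasSimpleSpectrum.inner_lindbladianInvAdj_lindbladian (hA : HasSimpleSpectrum A) (g : ℝ)
    (hX : ∀ j, specProj A j * X * specProj A j = 0) (Y : Matrix (Fin N) (Fin N) ℂ) :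
    ⟪lindbladianInvAdj A g X, lindbladian A g Y⟫ = ⟪X, Y⟫ := by
  have hP := hA.completeOrthogonalIdempotents_specProj
  rw [hA.lindbladian_eq_schurMul, inner_schurMul_right (isHermitian_specProj hA.isHermitian),
    lindbladianInvAdj, schurMul_schurMul hP.toOrthogonalIdempotents, schurMul_eq_self hP]
  intro j k
  obtain rfl | hjk := eq_or_ne j k
  · exact Or.inr (hX j)
  · simp only [Pi.mul_apply, Pi.star_apply, Pi.inv_apply, star_inv₀]
    exact Or.inl (mul_inv_cancel₀ (star_ne_zero.mpr (hA.rate_ne_zero g hjk)))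

lemma HasSimpleSpectrum.inner_lindbladianInvAdj_left (hA : HasSimpleSpectrum A) (g : ℝ)
    (X Y : Matrix (Fin N) (Fin N) ℂ) :
    ⟪lindbladianInvAdj A g X, Y⟫ = ⟪X, lindbladianInv A g Y⟫ :=
  (inner_schurMul_right (isHermitian_specProj hA.isHermitian) X Y).symm

lemma HasSimpleSpectrum.inner_self_lindbladianInv_nonpos (hA : HasSimpleSpectrum A) (hg : 0 ≤ g)
    (X : Matrix (Fin N) (Fin N) ℂ) : ⟪X, lindbladianInv A g X⟫ ≤ 0 :=
  inner_self_schurMul_nonpos hA.completeOrthogonalIdempotents_specProj.toOrthogonalIdempotents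
    (isHermitian_specProj hA.isHermitian) fun _ _ => re_inv_rate_nonpos hg

lemma HasSimpleSpectrum.inner_self_lindbladianInv (hA : HasSimpleSpectrum A) (g : ℝ) {a : Fin N}
    (hXherm : X.IsHermitian) (hX : X = specProj A a * X + X * specProj A a) :
    ⟪X, lindbladianInv A g X⟫ = -(2 * ∑ j ∈ Finset.univ.filter (· ≠ a),
      g * (specProj A j * X ^ 2).trace.re / ((energy A a - energy A j) ^ 2 + g ^ 2)) := by
  rw [lindbladianInv, inner_self_schurMul_of_eq_add
    hA.completeOrthogonalIdempotents_specProj.toOrthogonalIdempotents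
    (isHermitian_specProj hA.isHermitian) hXherm hX, Finset.mul_sum, ← Finset.sum_neg_distrib]
  refine Finset.sum_congr rfl fun j hj => ?_
  have hja : j ≠ a := (Finset.mem_filter.mp hj).2
  simp only [RCLike.re_eq_complex_re, re_inv_rate hja, re_inv_rate hja.symm]
  rw [← neg_sub (energy A a) (energy A j), neg_sq]
  ring

end Lindbladian

section IdempotentPath

variable {𝕜 R : Type*} [NontriviallyNormedField 𝕜] [NormedRing R] [NormedAlgebra 𝕜 R]
  {P : 𝕜 → R} {P' : R} {s : Set 𝕜} {x : 𝕜}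

lemma eq_mul_add_mul_of_hasDerivWithinAt (hP : HasDerivWithinAt P P' s x)
    (hs : UniqueDiffWithinAt 𝕜 s x) (hx : x ∈ s) (hidem : ∀ y ∈ s, IsIdempotentElem (P y)) :
    P' = P x * P' + P' * P x := by
  have hsq : HasDerivWithinAt P (P' * P x + P x * P') s x :=
    (hP.mul hP).congr_of_mem (fun y hy => (hidem y hy).eq.symm) hx
  rw [add_comm]
  exact hs.eq_deriv _ hP hsq

end IdempotentPath

section Path

open scoped RealInnerProductSpace

variable {N : ℕ}

section ContDiffOn

variable {E : Type*} [NormedAddCommGroup E] [NormedSpace ℝ E] {s : Set E} {n : WithTop ℕ∞}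
  {H X : E → Matrix (Fin N) (Fin N) ℂ} {γ : E → ℝ}

lemma contDiffOn_schurMul {P : E → Fin N → Matrix (Fin N) (Fin N) ℂ} {c : E → Fin N → Fin N → ℂ}
    (hP : ∀ a, ContDiffOn ℝ n (fun x => P x a) s) (hc : ∀ j k, ContDiffOn ℝ n (fun x => c x j k) s)
    (hX : ContDiffOn ℝ n X s) : ContDiffOn ℝ n (fun x => schurMul (P x) (c x) (X x)) s := by
  simp only [schurMul_apply]
  exact ContDiffOn.sum fun j _ => ContDiffOn.sum fun k _ =>
    (hc j k).smul (((hP j).mul hX).mul (hP k))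

lemma contDiffOn_inv_rate (hH : ContDiffOn ℝ n H s) (hn : n ≠ 0)
    (hsimple : ∀ x ∈ s, HasSimpleSpectrum (H x)) (hγ : ContDiffOn ℝ n γ s) (j k : Fin N) :
    ContDiffOn ℝ n (fun x => (rate (H x) (γ x))⁻¹ j k) s := by
  have hofReal : ∀ {f : E → ℝ}, ContDiffOn ℝ n f s → ContDiffOn ℝ n (fun x => (f x : ℂ)) s :=
    fun hf => Complex.ofRealCLM.contDiff.comp_contDiffOn hf
  obtain rfl | hjk := eq_or_ne j k
  · simpa only [Pi.inv_apply, rate_self] using contDiffOn_const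
  · refine ContDiffOn.inv ?_ fun x hx => (hsimple x hx).rate_ne_zero (γ x) hjk
    simp only [rate, if_pos hjk]
    exact (contDiffOn_const.mul ((hofReal (contDiffOn_energy hH hn hsimple j)).sub
      (hofReal (contDiffOn_energy hH hn hsimple k)))).sub (hofReal hγ)

lemma contDiffOn_lindbladianInv (hH : ContDiffOn ℝ n H s) (hn : n ≠ 0)
    (hsimple : ∀ x ∈ s, HasSimpleSpectrum (H x)) (hγ : ContDiffOn ℝ n γ s)
    (hX : ContDiffOn ℝ n X s) : ContDiffOn ℝ n (fun x => lindbladianInv (H x) (γ x) (X x)) s :=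
  contDiffOn_schurMul (contDiffOn_specProj hH hn hsimple)
    (contDiffOn_inv_rate hH hn hsimple hγ) hX

lemma contDiffOn_lindbladianInvAdj (hH : ContDiffOn ℝ n H s) (hn : n ≠ 0)
    (hsimple : ∀ x ∈ s, HasSimpleSpectrum (H x)) (hγ : ContDiffOn ℝ n γ s)
    (hX : ContDiffOn ℝ n X s) : ContDiffOn ℝ n (fun x => lindbladianInvAdj (H x) (γ x) (X x)) s :=
  contDiffOn_schurMul (contDiffOn_specProj hH hn hsimple) (fun j k =>
    Complex.conjCLE.contDiff.comp_contDiffOn (contDiffOn_inv_rate hH hn hsimple hγ j k)) hX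

end ContDiffOn

variable [NeZero N] {H : ℝ → Matrix (Fin N) (Fin N) ℂ} {γ : ℝ → ℝ} {x : ℝ}

lemma contDiffOn_groundProjDeriv {n : WithTop ℕ∞} (hH : ContDiffOn ℝ (n + 1) H (Icc 0 1))
    (hsimple : ∀ x ∈ Icc (0 : ℝ) 1, HasSimpleSpectrum (H x)) :
    ContDiffOn ℝ n (groundProjDeriv H) (Icc 0 1) :=
  (contDiffOn_specProj hH (by simp) hsimple 0).derivWithin (uniqueDiffOn_Icc zero_lt_one) le_rfl

lemma hasDerivWithinAt_groundProj (hH : ContDiffOn ℝ 1 H (Icc 0 1))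
    (hsimple : ∀ x ∈ Icc (0 : ℝ) 1, HasSimpleSpectrum (H x)) (hx : x ∈ Icc (0 : ℝ) 1) :
    HasDerivWithinAt (fun y => specProj (H y) 0) (groundProjDeriv H x) (Icc 0 1) x :=
  ((contDiffOn_specProj hH one_ne_zero hsimple 0).differentiableOn one_ne_zero x
    hx).hasDerivWithinAt

lemma groundProjDeriv_eq_mul_add_mul (hH : ContDiffOn ℝ 1 H (Icc 0 1))
    (hsimple : ∀ x ∈ Icc (0 : ℝ) 1, HasSimpleSpectrum (H x)) (hx : x ∈ Icc (0 : ℝ) 1) :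
    groundProjDeriv H x =
      specProj (H x) 0 * groundProjDeriv H x + groundProjDeriv H x * specProj (H x) 0 :=
  eq_mul_add_mul_of_hasDerivWithinAt (P := fun y => specProj (H y) 0)
    (hasDerivWithinAt_groundProj hH hsimple hx) (uniqueDiffOn_Icc zero_lt_one x hx) hx fun y hy =>
      (hsimple y hy).completeOrthogonalIdempotents_specProj.idem 0

lemma specProj_mul_groundProjDeriv_mul_specProj (hH : ContDiffOn ℝ 1 H (Icc 0 1))
    (hsimple : ∀ x ∈ Icc (0 : ℝ) 1, HasSimpleSpectrum (H x)) (hx : x ∈ Icc (0 : ℝ) 1)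
    (j : Fin N) : specProj (H x) j * groundProjDeriv H x * specProj (H x) j = 0 :=
  mul_mul_eq_zero_of_eq_add
    (hsimple x hx).completeOrthogonalIdempotents_specProj.toOrthogonalIdempotents
    (groundProjDeriv_eq_mul_add_mul hH hsimple hx) Iff.rfl

lemma isHermitian_groundProjDeriv (hH : ContDiffOn ℝ 1 H (Icc 0 1))
    (hsimple : ∀ x ∈ Icc (0 : ℝ) 1, HasSimpleSpectrum (H x)) (hx : x ∈ Icc (0 : ℝ) 1) :
    (groundProjDeriv H x).IsHermitian := by
  have hP := hasDerivWithinAt_groundProj hH hsimple hx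
  have hstar : HasDerivWithinAt (fun y => specProj (H y) 0) (star (groundProjDeriv H x))
      (Icc 0 1) x :=
    hP.star.congr_of_mem (fun y hy => (isHermitian_specProj (hsimple y hy).isHermitian 0).eq.symm)
      hx
  exact (uniqueDiffOn_Icc zero_lt_one x hx).eq_deriv _ hstar hP

lemma inner_groundProjDeriv_lindbladianInv (hH : ContDiffOn ℝ 1 H (Icc 0 1))
    (hsimple : ∀ x ∈ Icc (0 : ℝ) 1, HasSimpleSpectrum (H x)) (hx : x ∈ Icc (0 : ℝ) 1) :
    ⟪groundProjDeriv H x, lindbladianInv (H x) (γ x) (groundProjDeriv H x)⟫ =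
      -(2 * mass H γ x) :=
  (hsimple x hx).inner_self_lindbladianInv (γ x) (isHermitian_groundProjDeriv hH hsimple hx)
    (groundProjDeriv_eq_mul_add_mul hH hsimple hx)

lemma mass_nonneg (hH : ContDiffOn ℝ 1 H (Icc 0 1))
    (hsimple : ∀ x ∈ Icc (0 : ℝ) 1, HasSimpleSpectrum (H x)) (hγ : 0 ≤ γ x)
    (hx : x ∈ Icc (0 : ℝ) 1) : 0 ≤ mass H γ x := by
  have := (hsimple x hx).inner_self_lindbladianInv_nonpos hγ (groundProjDeriv H x)
  rw [inner_groundProjDeriv_lindbladianInv hH hsimple hx] at this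
  linarith

lemma continuousOn_mass (hH : ContDiffOn ℝ 2 H (Icc 0 1))
    (hsimple : ∀ x ∈ Icc (0 : ℝ) 1, HasSimpleSpectrum (H x)) (hγ : ContDiffOn ℝ 1 γ (Icc 0 1)) :
    ContinuousOn (mass H γ) (Icc 0 1) := by
  have hH₁ : ContDiffOn ℝ 1 H (Icc 0 1) := hH.of_le one_le_two
  have hX : ContDiffOn ℝ 1 (groundProjDeriv H) (Icc 0 1) :=
    contDiffOn_groundProjDeriv (by simpa [one_add_one_eq_two] using hH) hsimple
  have hinner := hX.continuousOn.inner
    (contDiffOn_lindbladianInv hH₁ one_ne_zero hsimple hγ hX).continuousOn (𝕜 := ℝ)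
  refine (hinner.const_smul (-2⁻¹ : ℝ)).congr fun x hx => ?_
  rw [Pi.smul_apply, smul_eq_mul, inner_groundProjDeriv_lindbladianInv hH₁ hsimple hx]
  ring

end Path

section SecondDerivative

variable {𝕜 E : Type*} [NontriviallyNormedField 𝕜] [NormedAddCommGroup E] [NormedSpace 𝕜 E]
  {f : 𝕜 → E} {s : Set 𝕜} {x : 𝕜}

lemma hasDerivWithinAt_derivWithin (hf : ContDiffOn 𝕜 2 f s) (hs : UniqueDiffOn 𝕜 s)
    (hx : x ∈ s) : HasDerivWithinAt (derivWithin f s) (iteratedDerivWithin 2 f s x) s x := by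
  have hf' : ContDiffOn 𝕜 1 (derivWithin f s) s := hf.derivWithin hs one_add_one_eq_two.le
  rw [iteratedDerivWithin_succ, iteratedDerivWithin_one]
  exact (hf'.differentiableOn one_ne_zero x hx).hasDerivWithinAt

end SecondDerivative

section Parametrization

variable {E : Type*} [NormedAddCommGroup E] [NormedSpace ℝ E]

/-- `q` is a `C²` parametrization of `[0, 1]` whose first two derivatives are bounded by `K`; the
adiabatic expansion is uniform in these. -/
structure IsParametrization (q : ℝ → ℝ) (K : ℝ) : Prop where
  contDiffOn : ContDiffOn ℝ 2 q (Icc 0 1)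
  mapsTo : MapsTo q (Icc 0 1) (Icc 0 1)
  abs_deriv_le : ∀ s ∈ Icc (0 : ℝ) 1, |derivWithin q (Icc 0 1) s| ≤ K
  abs_deriv_two_le : ∀ s ∈ Icc (0 : ℝ) 1, |iteratedDerivWithin 2 q (Icc 0 1) s| ≤ K

lemma exists_bound_velocity {F : ℝ → E} (hF : ContDiffOn ℝ 1 F (Icc 0 1)) (K : ℝ) :
    ∃ C, ∀ q, IsParametrization q K → ∃ V : ℝ → E, ∀ s ∈ Icc (0 : ℝ) 1,
      HasDerivWithinAt (fun t => derivWithin q (Icc 0 1) t • F (q t)) (V s) (Icc 0 1) s ∧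
      ‖derivWithin q (Icc 0 1) s • F (q s)‖ ≤ C ∧ ‖V s‖ ≤ C := by
  obtain ⟨C₁, hC₁⟩ := isCompact_Icc.exists_bound_of_continuousOn hF.continuousOn
  obtain ⟨C₂, hC₂⟩ := isCompact_Icc.exists_bound_of_continuousOn
    (hF.continuousOn_derivWithin (uniqueDiffOn_Icc zero_lt_one) le_rfl)
  refine ⟨max (K * C₁) (K * (K * C₂) + K * C₁), fun q hq =>
    ⟨fun s => derivWithin q (Icc 0 1) s • derivWithin q (Icc 0 1) s • derivWithin F (Icc 0 1) (q s)
      + iteratedDerivWithin 2 q (Icc 0 1) s • F (q s), fun s hs => ?_⟩⟩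
  have hK : 0 ≤ K := (abs_nonneg _).trans (hq.abs_deriv_le s hs)
  have hqs := hq.mapsTo hs
  have hsmul : ∀ {c C : ℝ} {v : E}, |c| ≤ K → ‖v‖ ≤ C → ‖c • v‖ ≤ K * C := fun hc hv => by
    rw [norm_smul]
    exact mul_le_mul hc hv (norm_nonneg _) hK
  have hchain : HasDerivWithinAt (fun t => F (q t))
      (derivWithin q (Icc 0 1) s • derivWithin F (Icc 0 1) (q s)) (Icc 0 1) s :=
    (hF.differentiableOn one_ne_zero (q s) hqs).hasDerivWithinAt.scomp s
      (hq.contDiffOn.differentiableOn two_ne_zero s hs).hasDerivWithinAt hq.mapsTo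
  have hq₁ := hq.abs_deriv_le s hs
  exact ⟨(hasDerivWithinAt_derivWithin hq.contDiffOn (uniqueDiffOn_Icc zero_lt_one) hs).smul hchain,
    (hsmul hq₁ (hC₁ _ hqs)).trans (le_max_left _ _),
    (norm_add_le_of_le (hsmul hq₁ (hsmul hq₁ (hC₂ _ hqs)))
      (hsmul (hq.abs_deriv_two_le s hs) (hC₁ _ hqs))).trans (le_max_right _ _)⟩

end Parametrization

section Tunneling

open scoped RealInnerProductSpace

variable {N : ℕ} {A : Matrix (Fin N) (Fin N) ℂ}

lemma inner_specProj_eq_re_trace (hA : A.IsHermitian) (a : Fin N)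
    (X : Matrix (Fin N) (Fin N) ℂ) : ⟪specProj A a, X⟫ = (specProj A a * X).trace.re := by
  rw [frobenius_inner_def, (isHermitian_specProj hA a).eq, RCLike.re_eq_complex_re]

lemma HasSimpleSpectrum.norm_specProj_sq (hA : HasSimpleSpectrum A) (a : Fin N) :
    ‖specProj A a‖ ^ 2 = 1 := by
  rw [← real_inner_self_eq_norm_sq, inner_specProj_eq_re_trace hA.isHermitian,
    hA.completeOrthogonalIdempotents_specProj.idem a, hA.trace_specProj, Complex.one_re]

variable [NeZero N] {H : ℝ → Matrix (Fin N) (Fin N) ℂ} {γ q : ℝ → ℝ} {s : ℝ}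

lemma hasDerivWithinAt_groundProj_comp (hH : ContDiffOn ℝ 1 H (Icc 0 1))
    (hsimple : ∀ x ∈ Icc (0 : ℝ) 1, HasSimpleSpectrum (H x))
    (hq : DifferentiableOn ℝ q (Icc 0 1)) (hqI : MapsTo q (Icc 0 1) (Icc 0 1))
    (hs : s ∈ Icc (0 : ℝ) 1) :
    HasDerivWithinAt (fun t => specProj (H (q t)) 0)
      (derivWithin q (Icc 0 1) s • groundProjDeriv H (q s)) (Icc 0 1) s :=
  (hasDerivWithinAt_groundProj hH hsimple (hqI hs)).scomp s (hq s hs).hasDerivWithinAt hqI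

lemma inner_velocity_eq_mass (hH : ContDiffOn ℝ 1 H (Icc 0 1))
    (hsimple : ∀ x ∈ Icc (0 : ℝ) 1, HasSimpleSpectrum (H x)) {x : ℝ} (hx : x ∈ Icc (0 : ℝ) 1)
    (v : ℝ) :
    ⟪v • lindbladianInvAdj (H x) (γ x) (groundProjDeriv H x), v • groundProjDeriv H x⟫ =
      -2 * (mass H γ x * v ^ 2) := by
  rw [real_inner_smul_left, real_inner_smul_right, (hsimple x hx).inner_lindbladianInvAdj_left,
    inner_groundProjDeriv_lindbladianInv hH hsimple hx]
  ring

lemma tunneling_sub_integral_mass_eq (hH : ContDiffOn ℝ 1 H (Icc 0 1))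
    (hsimple : ∀ x ∈ Icc (0 : ℝ) 1, HasSimpleSpectrum (H x)) (hqI : MapsTo q (Icc 0 1) (Icc 0 1))
    (ε : ℝ) (ρ : ℝ → Matrix (Fin N) (Fin N) ℂ) :
    tunneling H q ρ 1 - 2 * ε * ∫ s in (0 : ℝ)..1,
        mass H γ (q s) * derivWithin q (Icc 0 1) s ^ 2 =
      -(⟪specProj (H (q 1)) 0, ρ 1⟫ - ‖specProj (H (q 0)) 0‖ ^ 2 - ε * ∫ s in (0 : ℝ)..1,
        ⟪derivWithin q (Icc 0 1) s •
            lindbladianInvAdj (H (q s)) (γ (q s)) (groundProjDeriv H (q s)),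
          derivWithin q (Icc 0 1) s • groundProjDeriv H (q s)⟫) := by
  have h₀ := hsimple _ (hqI (left_mem_Icc.mpr zero_le_one))
  have h₁ := hsimple _ (hqI (right_mem_Icc.mpr zero_le_one))
  have hmass : ∀ s ∈ uIcc (0 : ℝ) 1, ⟪derivWithin q (Icc 0 1) s •
      lindbladianInvAdj (H (q s)) (γ (q s)) (groundProjDeriv H (q s)),
      derivWithin q (Icc 0 1) s • groundProjDeriv H (q s)⟫ =
        -2 * (mass H γ (q s) * derivWithin q (Icc 0 1) s ^ 2) := fun s hs =>
    inner_velocity_eq_mass hH hsimple (hqI (uIcc_of_le (zero_le_one' ℝ) ▸ hs)) _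
  rw [intervalIntegral.integral_congr hmass, intervalIntegral.integral_const_mul,
    h₀.norm_specProj_sq, inner_specProj_eq_re_trace h₁.isHermitian, tunneling]
  ring

lemma continuousOn_mass_comp (hH : ContDiffOn ℝ 2 H (Icc 0 1))
    (hsimple : ∀ x ∈ Icc (0 : ℝ) 1, HasSimpleSpectrum (H x)) (hγ : ContDiffOn ℝ 1 γ (Icc 0 1))
    (hq : ContDiffOn ℝ 1 q (Icc 0 1)) (hqI : MapsTo q (Icc 0 1) (Icc 0 1)) :
    ContinuousOn (fun s => mass H γ (q s) * derivWithin q (Icc 0 1) s ^ 2) (Icc 0 1) :=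
  ((continuousOn_mass hH hsimple hγ).comp hq.continuousOn hqI).mul
    ((hq.continuousOn_derivWithin (uniqueDiffOn_Icc zero_lt_one) le_rfl).pow 2)

lemma exists_norm_sub_groundProj_le (hH : ContDiffOn ℝ 2 H (Icc 0 1))
    (hsimple : ∀ x ∈ Icc (0 : ℝ) 1, HasSimpleSpectrum (H x)) (hγ : ContDiffOn ℝ 1 γ (Icc 0 1))
    (hγ_nonneg : ∀ x ∈ Icc (0 : ℝ) 1, 0 ≤ γ x) (K : ℝ) :
    ∃ R, ∀ q, IsParametrization q K → ∀ ε > 0, ∀ ρ, IsAdiabaticEvolution H γ q ε ρ →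
      ∀ s ∈ Icc (0 : ℝ) 1, ‖ρ s - specProj (H (q s)) 0‖ ≤ ε * R := by
  have hH₁ : ContDiffOn ℝ 1 H (Icc 0 1) := hH.of_le one_le_two
  have hX : ContDiffOn ℝ 1 (groundProjDeriv H) (Icc 0 1) :=
    contDiffOn_groundProjDeriv (one_add_one_eq_two (R := WithTop ℕ∞) ▸ hH) hsimple
  obtain ⟨β, hβ⟩ := exists_bound_velocity
    (contDiffOn_lindbladianInv hH₁ one_ne_zero hsimple hγ hX) K
  refine ⟨2 * β + β * (1 - 0), fun q hq ε hε ρ hρ s hs => ?_⟩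
  obtain ⟨V, hV⟩ := hβ q hq
  choose! ρ' hρ' using hρ.evolve
  have hspec : ∀ t ∈ Icc (0 : ℝ) 1, HasSimpleSpectrum (H (q t)) := fun t ht =>
    hsimple _ (hq.mapsTo ht)
  refine norm_sub_le_of_dissipative (L := fun t => lindbladian (H (q t)) (γ (q t)))
    (P := fun t => specProj (H (q t)) 0) hε
    (fun t ht => (hspec t ht).isLinearMap_lindbladian _)
    (fun t ht => (hspec t ht).inner_self_lindbladian_nonpos (hγ_nonneg _ (hq.mapsTo ht)))
    (fun t ht => (hρ' t ht).1) (fun t ht => (hρ' t ht).2)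
    (fun t ht => hasDerivWithinAt_groundProj_comp hH₁ hsimple
      (hq.contDiffOn.differentiableOn two_ne_zero) hq.mapsTo ht)
    (fun t ht => (hspec t ht).lindbladian_specProj _ 0)
    (fun t ht => (hV t ht).1) (fun t ht => ?_)
    (fun t ht => (hV t ht).2.1) (fun t ht => (hV t ht).2.2) hρ.init hs
  rw [((hspec t ht).isLinearMap_lindbladian _).map_smul, (hspec t ht).lindbladian_lindbladianInv _
    (specProj_mul_groundProjDeriv_mul_specProj hH₁ hsimple (hq.mapsTo ht))]

lemma exists_abs_tunneling_sub_le (hH : ContDiffOn ℝ 2 H (Icc 0 1))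
    (hsimple : ∀ x ∈ Icc (0 : ℝ) 1, HasSimpleSpectrum (H x)) (hγ : ContDiffOn ℝ 1 γ (Icc 0 1))
    (hγ_nonneg : ∀ x ∈ Icc (0 : ℝ) 1, 0 ≤ γ x) (K : ℝ) :
    ∃ C, ∀ q, IsParametrization q K → ∀ ε > 0, ∀ ρ, IsAdiabaticEvolution H γ q ε ρ →
      |tunneling H q ρ 1 - 2 * ε * ∫ s in (0 : ℝ)..1,
        mass H γ (q s) * derivWithin q (Icc 0 1) s ^ 2| ≤ C * ε ^ 2 := by
  have hH₁ : ContDiffOn ℝ 1 H (Icc 0 1) := hH.of_le one_le_two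
  have hX : ContDiffOn ℝ 1 (groundProjDeriv H) (Icc 0 1) :=
    contDiffOn_groundProjDeriv (one_add_one_eq_two (R := WithTop ℕ∞) ▸ hH) hsimple
  obtain ⟨R, hR⟩ := exists_norm_sub_groundProj_le hH hsimple hγ hγ_nonneg K
  obtain ⟨β, hβ⟩ := exists_bound_velocity
    (contDiffOn_lindbladianInvAdj hH₁ one_ne_zero hsimple hγ hX) K
  refine ⟨(β + β * (1 - 0)) * R, fun q hq ε hε ρ hρ => ?_⟩
  obtain ⟨V, hV⟩ := hβ q hq
  choose! ρ' hρ' using hρ.evolve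
  have hspec : ∀ t ∈ Icc (0 : ℝ) 1, HasSimpleSpectrum (H (q t)) := fun t ht =>
    hsimple _ (hq.mapsTo ht)
  rw [tunneling_sub_integral_mass_eq hH₁ hsimple hq.mapsTo, abs_neg]
  refine abs_inner_sub_sub_integral_le (L := fun t => lindbladian (H (q t)) (γ (q t)))
    (P := fun t => specProj (H (q t)) 0) zero_le_one hε
    (fun t ht => (hρ' t ht).1) (fun t ht => (hρ' t ht).2)
    (fun t ht => hasDerivWithinAt_groundProj_comp hH₁ hsimple
      (hq.contDiffOn.differentiableOn two_ne_zero) hq.mapsTo ht)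
    (fun t ht => (hspec t ht).inner_specProj_lindbladian _ 0)
    (fun t ht => (hV t ht).1) (fun t ht X => ?_)
    (hV 1 (right_mem_Icc.mpr zero_le_one)).2.1 (fun t ht => (hV t ht).2.2)
    (((continuousOn_mass_comp hH hsimple hγ (hq.contDiffOn.of_le one_le_two)
      hq.mapsTo).const_mul (-2)).congr fun t ht => ?_) (hR q hq ε hε ρ hρ) hρ.init
  · rw [real_inner_smul_left, real_inner_smul_left,
      (hspec t ht).inner_lindbladianInvAdj_lindbladian _
        (specProj_mul_groundProjDeriv_mul_specProj hH₁ hsimple (hq.mapsTo ht))]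
  · exact inner_velocity_eq_mass hH₁ hsimple (hq.mapsTo ht) _

end Tunneling

end Dephasing

theorem theorem2 {N : ℕ} [NeZero N] (H : ℝ → Matrix (Fin N) (Fin N) ℂ) (γ : ℝ → ℝ)
    (hH : ContDiffOn ℝ 2 H (Icc 0 1))
    (hHerm : ∀ x ∈ Icc (0 : ℝ) 1, (H x).IsHermitian)
    (hγ : ContDiffOn ℝ 1 γ (Icc 0 1))
    (hγ_nonneg : ∀ x ∈ Icc (0 : ℝ) 1, 0 ≤ γ x)
    (hgap : ∀ x ∈ Icc (0 : ℝ) 1, ∀ a b : Fin N, a ≠ b →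
      Dephasing.energy (H x) a ≠ Dephasing.energy (H x) b) :
    DifferentiableOn ℝ (fun x => Dephasing.specProj (H x) 0) (Icc 0 1) ∧
    (∀ x ∈ Icc (0 : ℝ) 1, 0 ≤ Dephasing.mass H γ x) ∧
    (∀ q : ℝ → ℝ, ContDiffOn ℝ 2 q (Icc 0 1) → MapsTo q (Icc 0 1) (Icc 0 1) →
      IntervalIntegrable
        (fun s => Dephasing.mass H γ (q s) * derivWithin q (Icc 0 1) s ^ 2) volume 0 1) ∧
    ∀ K : ℝ, ∃ C : ℝ, ∀ q : ℝ → ℝ, ContDiffOn ℝ 2 q (Icc 0 1) → MapsTo q (Icc 0 1) (Icc 0 1) →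
      (∀ s ∈ Icc (0 : ℝ) 1, |derivWithin q (Icc 0 1) s| ≤ K ∧
        |iteratedDerivWithin 2 q (Icc 0 1) s| ≤ K) →
      ∀ ε : ℝ, 0 < ε → ∀ ρ : ℝ → Matrix (Fin N) (Fin N) ℂ,
        Dephasing.IsAdiabaticEvolution H γ q ε ρ →
        |Dephasing.tunneling H q ρ 1 -
          2 * ε * ∫ s in (0 : ℝ)..1,
            Dephasing.mass H γ (q s) * derivWithin q (Icc 0 1) s ^ 2| ≤ C * ε ^ 2 := by
  have hsimple : ∀ x ∈ Icc (0 : ℝ) 1, Dephasing.HasSimpleSpectrum (H x) := fun x hx =>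
    ⟨hHerm x hx, fun a b => not_imp_not.mp (hgap x hx a b)⟩
  have hH₁ : ContDiffOn ℝ 1 H (Icc 0 1) := hH.of_le one_le_two
  refine ⟨(Dephasing.contDiffOn_specProj hH₁ one_ne_zero hsimple 0).differentiableOn one_ne_zero,
    fun x hx => Dephasing.mass_nonneg hH₁ hsimple (hγ_nonneg x hx) hx, fun q hq hqI => ?_,
    fun K => ?_⟩
  · exact (Dephasing.continuousOn_mass_comp hH hsimple hγ (hq.of_le one_le_two)
      hqI).intervalIntegrable_of_Icc zero_le_one
  · obtain ⟨C, hC⟩ := Dephasing.exists_abs_tunneling_sub_le hH hsimple hγ hγ_nonneg K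
    exact ⟨C, fun q hq hqI hK =>
      hC q ⟨hq, hqI, fun s hs => (hK s hs).1, fun s hs => (hK s hs).2⟩⟩
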